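/- Let $\mathscr A,\mathscr B,\mathscr C$ be abelian categories and let $(\mathscr A,\mathscr B,\mathscr C)$ be a recollement, that is, functors $\mathsf i\colon\mathscr A\to\mathscr B$, $\mathsf e\colon\mathscr B\to\mathscr C$, $\mathsf q,\mathsf p\colon\mathscr B\to\mathscr A$ and $\mathsf l,\mathsf r\colon\mathscr C\to\mathscr B$ such that $(\mathsf l,\mathsf e)$, $(\mathsf e,\mathsf r)$, $(\mathsf q,\mathsf i)$, $(\mathsf i,\mathsf p)$ are adjoint pairs, $\mathsf i,\mathsf l,\mathsf r$ are fully faithful, and the essential image of $\mathsf i$ is $\operatorname{Ker}\mathsf e=\{B\in\mathscr B\mid \mathsf e(B)=0\}$. Assume that $\mathscr B$ has enough projectives and enough injectives. Let $H\colon\mathscr B\to\mathscr B$ be the endofunctor given by the exact sequences $$0\to H(B)\to B\to \mathsf i\mathsf q(B)\to 0,$$ where $B\to\mathsf i\mathsf q(B)$ is the unit of the adjoint pair $(\mathsf q,\mathsf i)$. For $m\ge 1$ let $\Sigma^m(\mathscr B)$ be the class of all objects of $\mathscr B$ isomorphic to the image of $I^{m-1}\to I^m$ for some injective coresolution $0\to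 B\to I^0\to I^1\to\cdots$ of some object $B$ of $\mathscr B$. Let $\operatorname{Proj}\mathscr A$ be the class of projective objects of $\mathscr A$, and let $\mathsf i(\operatorname{Proj}\mathscr A)^{{}_1\perp_\infty}$ be the class of all $B\in\mathscr B$ with $\operatorname{Ext}^n_{\mathscr B}(\mathsf i(P),B)=0$ for all $P\in\operatorname{Proj}\mathscr A$ and all $n\ge 1$. The projective dimension of a zero object is $-\infty$. Let $m\geq 1$ be an integer. The following are equivalent: (i) $\sup\{\operatorname{pd}_{\mathscr B}\mathsf i(P)\mid P\in\operatorname{Proj}\mathscr A\}\le m$. (ii) $\Sigma^m(\mathscr B)\subseteq \mathsf i(\operatorname{Proj}\mathscr A)^{{}_1\perp_\infty}$. (iii) For every projective object $P$ of $\mathscr B$, $\operatorname{pd}_{\mathscr B}H(P)\le m-1$. If $m=1$, then these conditions are also equivalent to: (iv) The functor $\mathsf i$ is a homological embedding, that is, the maps $\operatorname{Ext}^n_{\mathscr A}(X,Y)\to\operatorname{Ext}^n_{\mathscr B}(\mathsf i(X),\mathsf i(Y))$ induced by the exact functor $\mathsf i$ are isomorphisms for all $X,Y\in\mathscr A$ and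 all $n\ge 0$; and the functor $\mathsf e\colon\mathscr B\to\mathscr C$ preserves projective objects. -/

import Mathlib

open CategoryTheory CategoryTheory.Limits

universe w w' v₁ v₂ v₃ u₁ u₂ u₃

noncomputable section

/-- A recollement `(A, B, C)` of abelian categories: functors `i : A ⥤ B`, `e : B ⥤ C`, adjoint
triples `(q, i, p)` and `(l, e, r)`, with `i`, `l`, `r` fully faithful and `Im i = Ker e`, where
`Im i` is the essential image of `i` and `Ker e` consists of the objects sent to zero by `e`. -/
structure AbelianRecollement (A : Type u₁) (B : Type u₂) (C : Type u₃)
    [Category.{v₁} A] [Category.{v₂} B] [Category.{v₃} C]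
    [Abelian A] [Abelian B] [Abelian C] where
  /-- the inclusion functor -/
  i : A ⥤ B
  /-- the quotient functor -/
  e : B ⥤ C
  /-- the left adjoint of `i` -/
  q : B ⥤ A
  /-- the right adjoint of `i` -/
  p : B ⥤ A
  /-- the left adjoint of `e` -/
  l : C ⥤ B
  /-- the right adjoint of `e` -/
  r : C ⥤ B
  adjLE : l ⊣ e
  adjER : e ⊣ r
  adjQI : q ⊣ i
  adjIP : i ⊣ p
  full_i : i.Full
  faithful_i : i.Faithful
  full_l : l.Full
  faithful_l : l.Faithful
  full_r : r.Full
  faithful_r : r.Faithful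
  essImage_i_eq_kernel_e : i.essImage = e.kernel

namespace AbelianRecollement

variable {A : Type u₁} {B : Type u₂} {C : Type u₃}
  [Category.{v₁} A] [Category.{v₂} B] [Category.{v₃} C]
  [Abelian A] [Abelian B] [Abelian C]

instance preservesFiniteLimits_i (R : AbelianRecollement A B C) : PreservesFiniteLimits R.i :=
  have := R.adjQI.rightAdjoint_preservesLimits
  PreservesLimits.preservesFiniteLimits R.i

instance preservesFiniteColimits_i (R : AbelianRecollement A B C) :
    PreservesFiniteColimits R.i :=
  have := R.adjIP.leftAdjoint_preservesColimits
  PreservesColimits.preservesFiniteColimits R.i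

instance additive_i (R : AbelianRecollement A B C) : R.i.Additive :=
  R.i.additive_of_preserves_binary_products

/-- The endofunctor `H` of `B`, the kernel of the unit of the adjunction `(q, i)`; on objects it
is given by the exact sequence `0 ⟶ H(X) ⟶ X ⟶ i(q(X)) ⟶ 0`. -/
@[simps]
def H (R : AbelianRecollement A B C) : B ⥤ B where
  obj X := kernel (R.adjQI.unit.app X)
  map {X Y} f := kernel.map (R.adjQI.unit.app X) (R.adjQI.unit.app Y) f (R.i.map (R.q.map f))
    (R.adjQI.unit.naturality f).symm
  map_id X := by
    rw [← cancel_mono (kernel.ι _)]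
    simp
  map_comp f g := by
    rw [← cancel_mono (kernel.ι _)]
    simp

/-- The sequence `0 ⟶ H(X) ⟶ X ⟶ i(q(X)) ⟶ 0` is also exact on the right. -/
theorem epi_unit_app (R : AbelianRecollement A B C) (X : B) : Epi (R.adjQI.unit.app X) := by
  have := R.adjER.leftAdjoint_preservesColimits
  have := R.adjLE.rightAdjoint_preservesLimits
  have : R.e.Additive := R.e.additive_of_preserves_binary_products
  have := R.full_i
  have := R.faithful_i
  set f := R.adjQI.unit.app X with hf
  have h1 : R.e.kernel (R.i.obj (R.q.obj X)) := by
    rw [← R.essImage_i_eq_kernel_e]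
    exact R.i.obj_mem_essImage _
  have h2 : R.e.kernel (Abelian.image f) :=
    IsZero.of_mono (R.e.map (Abelian.image.ι f)) h1
  rw [← R.essImage_i_eq_kernel_e] at h2
  obtain ⟨Z, ⟨t⟩⟩ := h2
  let g : R.q.obj X ⟶ Z := (R.adjQI.homEquiv X Z).symm (Abelian.factorThruImage f ≫ t.inv)
  have hg : f ≫ R.i.map g = Abelian.factorThruImage f ≫ t.inv := by
    have := (R.adjQI.homEquiv X Z).apply_symm_apply (Abelian.factorThruImage f ≫ t.inv)
    rwa [Adjunction.homEquiv_unit] at this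
  have hk : g ≫ R.i.preimage (t.hom ≫ Abelian.image.ι f) = 𝟙 _ := by
    apply (R.adjQI.homEquiv X _).injective
    simp only [Adjunction.homEquiv_unit, Functor.map_comp, Functor.map_preimage]
    rw [← hf, reassoc_of% hg]
    simp
  have hs : (R.i.map g ≫ t.hom) ≫ Abelian.image.ι f = 𝟙 _ := by
    have := congrArg R.i.map hk
    simpa using this
  have : IsSplitEpi (Abelian.image.ι f) := ⟨⟨⟨_, hs⟩⟩⟩
  rw [← Abelian.image.fac f]
  infer_instance

end AbelianRecollement

/-- The class `Σ^m(B)` of `m`-th cosyzygy objects: for `m ≥ 1`, the objects isomorphic to the image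
of `I^{m-1} ⟶ I^m` for some injective resolution `0 ⟶ Y ⟶ I^0 ⟶ I^1 ⟶ ⋯` of some object `Y`
(and all objects for `m = 0`). -/
def cosyzygies (B : Type u₂) [Category.{v₂} B] [Abelian B] : ℕ → ObjectProperty B
  | 0 => ⊤
  | n + 1 => fun X => ∃ (Y : B) (I : InjectiveResolution Y),
      Nonempty (X ≅ image (I.cocomplex.d n (n + 1)))

/-- The right `Ext`-orthogonal of a class `S` of objects in an abelian category: all `Y` with
`Ext^n(X, Y) = 0` for all `X` in `S` and all `n ≥ 1`. -/
def rightExtOrthogonal {B : Type u₂} [Category.{v₂} B] [Abelian B] [HasExt.{w} B]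
    (S : ObjectProperty B) : ObjectProperty B :=
  fun Y => ∀ X : B, S X → ∀ n : ℕ, 1 ≤ n → Subsingleton (Abelian.Ext X Y n)

/-- An exact functor is a homological embedding if it induces isomorphisms on all `Ext^n`,
`n ≥ 0`. -/
def IsHomologicalEmbedding {A : Type u₁} {B : Type u₂} [Category.{v₁} A] [Category.{v₂} B]
    [Abelian A] [Abelian B] [HasExt.{w'} A] [HasExt.{w} B] (F : A ⥤ B) [F.Additive]
    [PreservesFiniteLimits F] [PreservesFiniteColimits F] : Prop :=
  ∀ (X Y : A) (n : ℕ), Function.Bijective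
    (fun x : Abelian.Ext.{w'} X Y n => (x.mapExactFunctor F : Abelian.Ext.{w} _ _ n))

end

/-! (i) ⇔ (ii) is dimension shifting: positive Ext into an `m`-th cosyzygy of `Y` is Ext into `Y`,
`m` degrees higher. (i) ⇔ (iii): `0 ⟶ H(P) ⟶ P ⟶ i(q(P)) ⟶ 0` with `P` projective shifts projective
dimension by one, and every projective of `A` is a retract of some `q(P)`.

For `m = 1`, (iii) says that `H` preserves projectives. The key is the epimorphism `lEToH : l(e(P))
⟶ H(P)`: its kernel is killed by `e`, so it receives no nonzero map from `l(-)`, and `lEToH` is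
invertible as soon as it splits. If `H(P)` is projective it splits, so `e(P)` is projective;
moreover `i(q(P))` has no higher Ext into the image of `i`, which gives the homological embedding.
Conversely, a homological embedding kills `Ext¹(H(P), ker lEToH)`, so again `lEToH` splits. -/

open CategoryTheory CategoryTheory.Limits Abelian

/-! ### Dimension shifting and cosyzygies. -/

section DimensionShift

variable {B : Type u₂} [Category.{v₂} B] [Abelian B]

lemma shortExact_factorThruImage {X₁ X₂ X₃ : B} (f : X₁ ⟶ X₂) (g : X₂ ⟶ X₃) (w : f ≫ g = 0)
    (h : (ShortComplex.mk f g w).Exact) [Mono f] :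
    (ShortComplex.mk f (factorThruImage g)
      (by rw [← cancel_mono (Limits.image.ι g)]; simpa using w)).ShortExact :=
  have w' : f ≫ factorThruImage g = 0 := by
    rw [← cancel_mono (Limits.image.ι g)]
    simpa using w
  { exact := (ShortComplex.exact_iff_of_epi_of_isIso_of_mono
      (S₁ := ShortComplex.mk f (factorThruImage g) w') (S₂ := ShortComplex.mk f g w)
      { τ₁ := 𝟙 _, τ₂ := 𝟙 _, τ₃ := Limits.image.ι g }).2 h
    mono_f := by assumption
    epi_g := by dsimp; infer_instance }

lemma shortExact_image_ι_factorThruImage {X₁ X₂ X₃ : B} (f : X₁ ⟶ X₂) (g : X₂ ⟶ X₃)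
    (w : f ≫ g = 0) (h : (ShortComplex.mk f g w).Exact) :
    (ShortComplex.mk (Limits.image.ι f) (factorThruImage g)
      (by
        rw [← cancel_epi (factorThruImage f), ← cancel_mono (Limits.image.ι g)]
        simpa using w)).ShortExact :=
  have w' : Limits.image.ι f ≫ g = 0 := by
    rw [← cancel_epi (factorThruImage f)]
    simpa using w
  shortExact_factorThruImage _ _ w'
    ((ShortComplex.exact_iff_of_epi_of_isIso_of_mono
      (S₁ := ShortComplex.mk f g w) (S₂ := ShortComplex.mk (Limits.image.ι f) g w')
      { τ₁ := factorThruImage f, τ₂ := 𝟙 _, τ₃ := 𝟙 _ }).1 h)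

variable [HasExt.{w} B]

/-- Dimension shifting along a short exact sequence with injective middle term. -/
lemma subsingleton_ext_X₁_succ_iff {S : ShortComplex B} (hS : S.ShortExact) [Injective S.X₂]
    (X : B) {n k : ℕ} (hn : 1 ≤ n) (hk : n + 1 = k) :
    Subsingleton (Ext X S.X₁ k) ↔ Subsingleton (Ext X S.X₃ n) := by
  subst hk
  constructor
  · intro h
    refine subsingleton_of_forall_eq 0 fun x => ?_
    obtain ⟨y, rfl⟩ := Ext.covariant_sequence_exact₃ X hS x rfl (Subsingleton.elim _ _)
    -- Here `1 ≤ n` is essential: `Hom(X, S.X₂)` need not vanish.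
    obtain ⟨j, rfl⟩ := Nat.exists_eq_add_of_le' hn
    rw [Ext.eq_zero_of_injective y, Ext.zero_comp]
  · intro h
    refine subsingleton_of_forall_eq 0 fun x => ?_
    obtain ⟨y, rfl⟩ := Ext.covariant_sequence_exact₁ X hS x (Ext.eq_zero_of_injective _) rfl
    rw [Subsingleton.elim y 0, Ext.zero_comp]

/-- The image of `d m (m + 1)` is the cosyzygy of order `m + 1`, whence the shift by `m + 1`. -/
lemma CategoryTheory.InjectiveResolution.subsingleton_ext_iff {Y : B} (I : InjectiveResolution Y)
    (X : B) (m : ℕ) {n k : ℕ} (hn : 1 ≤ n) (hk : n + (m + 1) = k) :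
    Subsingleton (Ext X Y k) ↔ Subsingleton (Ext X (image (I.cocomplex.d m (m + 1))) n) := by
  induction m generalizing n k with
  | zero =>
    have : Injective (I.cocomplex.X 0) := I.injective 0
    exact subsingleton_ext_X₁_succ_iff
      (shortExact_factorThruImage _ _ I.ι_f_zero_comp_complex_d I.exact₀) X hn hk
  | succ m ih =>
    have : Injective (I.cocomplex.X (m + 1)) := I.injective (m + 1)
    rw [ih (n := n + 1) (by lia) (by lia)]
    exact subsingleton_ext_X₁_succ_iff
      (shortExact_image_ι_factorThruImage _ _ _ (I.exact_succ m)) X hn rfl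

/-- An object has projective dimension at most `m` if and only if all positive `Ext` groups from
it to `m`-th cosyzygies vanish. -/
lemma hasProjectiveDimensionLE_iff_cosyzygies [EnoughInjectives B] (X : B) {m : ℕ} (hm : 1 ≤ m) :
    HasProjectiveDimensionLE X m ↔
      ∀ Z, cosyzygies B m Z → ∀ n : ℕ, 1 ≤ n → Subsingleton (Ext.{w} X Z n) := by
  obtain ⟨m, rfl⟩ := Nat.exists_eq_add_of_le' hm
  constructor
  · rintro h Z ⟨Y, I, ⟨e⟩⟩ n hn
    have : Subsingleton (Ext X (image (I.cocomplex.d m (m + 1))) n) :=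
      (I.subsingleton_ext_iff X m hn rfl).1
        (HasProjectiveDimensionLT.subsingleton X (m + 1 + 1) _ (by lia) Y)
    refine subsingleton_of_forall_eq 0 fun x => ?_
    rw [← x.comp_mk₀_id, ← e.hom_inv_id, ← Ext.mk₀_comp_mk₀, ← Ext.comp_assoc_of_third_deg_zero,
      Subsingleton.elim (x.comp (Ext.mk₀ e.hom) (add_zero n)) 0, Ext.zero_comp]
  · intro h
    -- Vanishing in the single degree `m + 2` suffices, so only `Ext¹` into cosyzygies is needed.
    refine hasProjectiveDimensionLT_of_enoughInjectives.{w} X _ fun Y => ?_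
    let I := injectiveResolution Y
    exact (I.subsingleton_ext_iff X m le_rfl (by lia)).2
      (h _ ⟨Y, I, ⟨Iso.refl _⟩⟩ 1 le_rfl)

end DimensionShift

/-! ### A criterion for homological embeddings. -/

section HomologicalEmbedding

variable {A : Type u₁} {B : Type u₂} [Category.{v₁} A] [Category.{v₂} B] [Abelian A] [Abelian B]

/-- A fully faithful exact functor is a homological embedding as soon as every object of the source
is a quotient of a projective object whose image has no higher extensions by objects in the
image. -/
lemma isHomologicalEmbedding_of_forall_epi [HasExt.{w'} A] [HasExt.{w} B] (F : A ⥤ B) [F.Additive]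
    [PreservesFiniteLimits F] [PreservesFiniteColimits F] [F.Full] [F.Faithful]
    (hF : ∀ X : A, ∃ (P : A) (π : P ⟶ X), Projective P ∧ Epi π ∧
      ∀ (Y : A) (n : ℕ), Subsingleton (Ext.{w} (F.obj P) (F.obj Y) (n + 1))) :
    IsHomologicalEmbedding.{w, w'} F := by
  intro X Y n
  induction n generalizing X with
  | zero =>
    rw [Ext.mapExactFunctor₀]
    exact Ext.homEquiv₀.symm.bijective.comp
      (Function.Bijective.comp ⟨F.map_injective, F.map_surjective⟩ Ext.homEquiv₀.bijective)
  | succ n ih =>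
    obtain ⟨P, π, hP, hπ, hF⟩ := hF X
    let S := ShortComplex.mk (kernel.ι π) π (kernel.condition π)
    have hS : S.ShortExact := { exact := ShortComplex.exact_kernel π }
    have hS' := hS.map_of_exact F
    constructor
    · refine (injective_iff_map_eq_zero (F.mapExtAddHom X Y (n + 1))).2 fun x hx => ?_
      -- Since `P` is projective, `x` comes from degree `n` on the kernel of `π`.
      obtain ⟨y, rfl⟩ := Ext.contravariant_sequence_exact₃ hS Y x
        (Ext.eq_zero_of_projective (P := P) _) (add_comm 1 n)
      rw [F.mapExtAddHom_apply, Ext.mapExactFunctor_comp, Ext.mapExactFunctor_extClass] at hx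
      obtain ⟨z, hz⟩ := Ext.contravariant_sequence_exact₁ hS' (F.obj Y) _ _ hx
      -- The induction hypothesis is used at `P` for surjectivity and at the kernel for injectivity.
      obtain ⟨t, rfl⟩ := (ih P).2 z
      have : (Ext.mk₀ S.f).comp t (zero_add n) = y := (ih _).1 (by
        dsimp only
        rw [Ext.mapExactFunctor_comp, Ext.mapExactFunctor_mk₀]
        exact hz)
      rw [← this, ShortComplex.ShortExact.extClass_comp_assoc]
    · intro x
      obtain ⟨y, rfl⟩ := Ext.contravariant_sequence_exact₃ hS' (F.obj Y) x
        ((hF Y n).elim _ _) (add_comm 1 n)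
      obtain ⟨z, rfl⟩ := (ih _).2 y
      refine ⟨hS.extClass.comp z (add_comm 1 n), ?_⟩
      dsimp only
      rw [Ext.mapExactFunctor_comp, Ext.mapExactFunctor_extClass]
      rfl

end HomologicalEmbedding

/-! ### The recollement and the map `l(e(X)) ⟶ H(X)`. -/

namespace AbelianRecollement

variable {A : Type u₁} {B : Type u₂} {C : Type u₃}
  [Category.{v₁} A] [Category.{v₂} B] [Category.{v₃} C]
  [Abelian A] [Abelian B] [Abelian C] (R : AbelianRecollement A B C)

attribute [instance] full_i faithful_i full_l faithful_l epi_unit_app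

instance isLeftAdjoint_e : R.e.IsLeftAdjoint := R.adjER.isLeftAdjoint
instance isRightAdjoint_e : R.e.IsRightAdjoint := R.adjLE.isRightAdjoint
instance isLeftAdjoint_q : R.q.IsLeftAdjoint := R.adjQI.isLeftAdjoint
instance isLeftAdjoint_l : R.l.IsLeftAdjoint := R.adjLE.isLeftAdjoint

instance additive_e : R.e.Additive :=
  have := R.adjLE.rightAdjoint_preservesLimits.{0, 0}
  R.e.additive_of_preserves_binary_products

/-- The unit of `(l, e)` is invertible because `l` is fully faithful; the triangle identity does the
rest. -/
instance isIso_e_map_counit (X : B) : IsIso (R.e.map (R.adjLE.counit.app X)) := by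
  have := R.adjLE.right_triangle_components X
  exact IsIso.of_isIso_fac_left this

lemma isZero_e_obj_i (X : A) : IsZero (R.e.obj (R.i.obj X)) := by
  have : R.e.kernel (R.i.obj X) := by
    rw [← R.essImage_i_eq_kernel_e]
    exact R.i.obj_mem_essImage _
  exact this

lemma exists_iso_i {X : B} (hX : IsZero (R.e.obj X)) : ∃ Y, Nonempty (R.i.obj Y ≅ X) := by
  have : R.e.kernel X := hX
  rwa [← R.essImage_i_eq_kernel_e] at this

lemma eq_zero_of_l_to_i {X : C} {Y : B} (hY : IsZero (R.e.obj Y)) (f : R.l.obj X ⟶ Y) : f = 0 :=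
  (R.adjLE.homEquiv X Y).injective (hY.eq_of_tgt _ _)

/-- The canonical inclusion `H(X) ⟶ X`. -/
noncomputable def hι (X : B) : R.H.obj X ⟶ X := kernel.ι (R.adjQI.unit.app X)

instance mono_hι (X : B) : Mono (R.hι X) := inferInstanceAs (Mono (kernel.ι _))

/-- The short exact sequence `0 ⟶ H(X) ⟶ X ⟶ i(q(X)) ⟶ 0`. -/
noncomputable abbrev hSequence (X : B) : ShortComplex B :=
  ShortComplex.mk (X₁ := R.H.obj X) (X₂ := X) (R.hι X) (R.adjQI.unit.app X) (kernel.condition _)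

lemma shortExact_hSequence (X : B) : (R.hSequence X).ShortExact where
  exact := ShortComplex.exact_kernel _

/-- The canonical map `l(e(X)) ⟶ H(X)` induced by the counit `l(e(X)) ⟶ X`. -/
noncomputable def lEToH (X : B) : R.l.obj (R.e.obj X) ⟶ R.H.obj X :=
  kernel.lift _ (R.adjLE.counit.app X) (R.eq_zero_of_l_to_i (R.isZero_e_obj_i _) _)

lemma lEToH_ι (X : B) : R.lEToH X ≫ R.hι X = R.adjLE.counit.app X :=
  kernel.lift_ι _ _ _

/-- The cokernel of the counit is killed by `e`, hence lies in the image of `i`, so the projection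
onto it factors through the unit `X ⟶ i(q(X))`. Thus `H(X)` is the image of the counit. -/
instance epi_lEToH (X : B) : Epi (R.lEToH X) := by
  have w : R.adjLE.counit.app X ≫ R.adjQI.unit.app X = 0 :=
    R.eq_zero_of_l_to_i (R.isZero_e_obj_i _) _
  have hS : (ShortComplex.mk _ _ w).Exact := by
    rw [ShortComplex.exact_iff_kernel_ι_comp_cokernel_π_zero]
    dsimp only
    set π := cokernel.π (R.adjLE.counit.app X)
    have hz : IsZero (R.e.obj (cokernel (R.adjLE.counit.app X))) := by
      have h : R.e.map π = 0 := by
        rw [← cancel_epi (R.e.map (R.adjLE.counit.app X)), ← R.e.map_comp, cokernel.condition]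
        simp
      exact IsZero.of_epi_eq_zero _ h
    obtain ⟨Y, ⟨t⟩⟩ := R.exists_iso_i hz
    have h : R.adjQI.unit.app X ≫ R.i.map ((R.adjQI.homEquiv X Y).symm (π ≫ t.inv)) =
        π ≫ t.inv := by
      have := (R.adjQI.homEquiv X Y).apply_symm_apply (π ≫ t.inv)
      rwa [Adjunction.homEquiv_unit] at this
    rw [← cancel_mono t.inv, Category.assoc, ← h, kernel.condition_assoc, zero_comp, zero_comp]
  exact hS.epi_kernelLift

lemma isZero_e_obj_kernel_lEToH (X : B) : IsZero (R.e.obj (kernel (R.lEToH X))) := by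
  have h : R.e.map (kernel.ι (R.lEToH X)) = 0 := by
    rw [← cancel_mono (R.e.map (R.adjLE.counit.app X)), ← R.e.map_comp, ← R.lEToH_ι,
      kernel.condition_assoc]
    simp
  exact IsZero.of_mono_eq_zero _ h

/-- If the epimorphism `l(e(X)) ⟶ H(X)` splits, then it is an isomorphism. -/
lemma isIso_lEToH_of_section (X : B) (s : R.H.obj X ⟶ R.l.obj (R.e.obj X))
    (hs : s ≫ R.lEToH X = 𝟙 _) : IsIso (R.lEToH X) := by
  refine ⟨s, ?_, hs⟩
  -- The defect of `s` from being a left inverse lands in an object killed by `e`, so it vanishes.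
  let g : R.l.obj (R.e.obj X) ⟶ kernel (R.lEToH X) :=
    kernel.lift _ (𝟙 _ - R.lEToH X ≫ s) (by simp [hs])
  have hg : g ≫ kernel.ι _ = 𝟙 _ - R.lEToH X ≫ s := kernel.lift_ι _ _ _
  rw [R.eq_zero_of_l_to_i (R.isZero_e_obj_kernel_lEToH X) g, zero_comp] at hg
  exact (sub_eq_zero.1 hg.symm).symm

lemma projective_of_projective_l_obj (X : C) [Projective (R.l.obj X)] : Projective X where
  factors f g _ := ⟨R.l.preimage (Projective.factorThru (R.l.map f) (R.l.map g)),
    R.l.map_injective (by simp)⟩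

lemma projective_q_obj (P : B) [Projective P] : Projective (R.q.obj P) :=
  R.adjQI.map_projective P inferInstance

/-- The left adjoint `q` preserves epimorphisms, and `q(i(X)) ⟶ X` is invertible. -/
lemma exists_epi_q_obj [EnoughProjectives B] (X : A) :
    ∃ (P : B) (π : R.q.obj P ⟶ X), Projective P ∧ Epi π :=
  ⟨Projective.over (R.i.obj X), R.q.map (Projective.π _) ≫ R.adjQI.counit.app X,
    inferInstance, inferInstance⟩

lemma hasProjectiveDimensionLE_i_q_iff (P : B) [Projective P] (n : ℕ) :
    HasProjectiveDimensionLE (R.i.obj (R.q.obj P)) (n + 1) ↔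
      HasProjectiveDimensionLE (R.H.obj P) n :=
  (R.shortExact_hSequence P).hasProjectiveDimensionLT_X₃_iff n ‹_›

lemma forall_hasProjectiveDimensionLE_i_iff [EnoughProjectives B] (n : ℕ) :
    (∀ P : A, Projective P → HasProjectiveDimensionLE (R.i.obj P) (n + 1)) ↔
      ∀ P : B, Projective P → HasProjectiveDimensionLE (R.H.obj P) n := by
  constructor
  · intro h P hP
    exact (R.hasProjectiveDimensionLE_i_q_iff P n).1 (h _ (R.projective_q_obj P))
  · intro h P hP
    obtain ⟨Q, π, hQ, hπ⟩ := R.exists_epi_q_obj P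
    have := (R.hasProjectiveDimensionLE_i_q_iff Q n).2 (h Q hQ)
    let r : Retract P (R.q.obj Q) :=
      { i := Projective.factorThru (𝟙 P) π
        r := π
        retract := by simp }
    exact (r.map R.i).hasProjectiveDimensionLT _

/-! ### The case `m = 1`. -/

lemma eq_zero_of_H_to_i {X : B} {Y : A} (f : R.H.obj X ⟶ R.i.obj Y) : f = 0 := by
  rw [← cancel_epi (R.lEToH X), comp_zero]
  exact R.eq_zero_of_l_to_i (R.isZero_e_obj_i Y) _

/-- This `Ext¹` is a quotient of `Hom(H(P), i(Y)) = 0`; projectivity of `H(P)` only matters from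
degree 2 on. -/
lemma subsingleton_ext_one_i_q [HasExt.{w} B] (P : B) [Projective P] (Y : A) :
    Subsingleton (Ext.{w} (R.i.obj (R.q.obj P)) (R.i.obj Y) 1) := by
  refine subsingleton_of_forall_eq 0 fun x => ?_
  obtain ⟨y, rfl⟩ := Ext.contravariant_sequence_exact₃ (R.shortExact_hSequence P) (R.i.obj Y) x
    (Ext.eq_zero_of_projective (P := P) _) (add_zero 1)
  obtain ⟨f, rfl⟩ := (Ext.mk₀_bijective _ _).2 y
  rw [R.eq_zero_of_H_to_i f, Ext.mk₀_zero, Ext.comp_zero]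

lemma isHomologicalEmbedding_i [HasExt.{w'} A] [HasExt.{w} B] [EnoughProjectives B]
    (h : ∀ P : B, Projective P → Projective (R.H.obj P)) :
    IsHomologicalEmbedding.{w, w'} R.i := by
  refine isHomologicalEmbedding_of_forall_epi _ fun X => ?_
  obtain ⟨P, π, hP, hπ⟩ := R.exists_epi_q_obj X
  refine ⟨_, π, R.projective_q_obj P, hπ, ?_⟩
  rintro Y (_ | n)
  · exact R.subsingleton_ext_one_i_q P Y
  · have := h P hP
    have : HasProjectiveDimensionLE (R.i.obj (R.q.obj P)) 1 :=
      (R.hasProjectiveDimensionLE_i_q_iff P 0).2 inferInstance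
    exact HasProjectiveDimensionLT.subsingleton _ 2 _ (by lia) _

lemma projective_e_obj (P : B) [Projective (R.H.obj P)] : Projective (R.e.obj P) := by
  have := R.isIso_lEToH_of_section P (Projective.factorThru (𝟙 _) (R.lEToH P)) (by simp)
  have : Projective (R.l.obj (R.e.obj P)) := Projective.of_iso (asIso (R.lEToH P)).symm ‹_›
  exact R.projective_of_projective_l_obj _

/-- With `Y ≅ i(Z)`, the connecting map embeds this group in `Ext²(i(q(P)), i(Z)) ≅ Ext²(q(P), Z)`,
which is zero since `q(P)` is projective. -/
lemma subsingleton_ext_one_H [HasExt.{w'} A] [HasExt.{w} B]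
    (h : IsHomologicalEmbedding.{w, w'} R.i) (P : B) [Projective P] {Y : B}
    (hY : IsZero (R.e.obj Y)) : Subsingleton (Ext.{w} (R.H.obj P) Y 1) := by
  obtain ⟨Z, ⟨t⟩⟩ := R.exists_iso_i hY
  have := R.projective_q_obj P
  refine subsingleton_of_forall_eq 0 fun x => ?_
  have hx : (R.shortExact_hSequence P).extClass.comp (x.comp (Ext.mk₀ t.inv) (add_zero 1))
      (rfl : 1 + 1 = 2) = 0 := by
    obtain ⟨y, hy⟩ := (h (R.q.obj P) Z 2).2
      ((R.shortExact_hSequence P).extClass.comp (x.comp (Ext.mk₀ t.inv) (add_zero 1)) rfl)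
    rw [← hy, Ext.eq_zero_of_projective y]
    exact Ext.mapExactFunctor_zero _ _ _ _
  obtain ⟨y, hy⟩ := Ext.contravariant_sequence_exact₁ _ _ _ _ hx
  rw [Ext.eq_zero_of_projective (P := P) y, Ext.comp_zero] at hy
  rw [← x.comp_mk₀_id, ← t.inv_hom_id, ← Ext.mk₀_comp_mk₀, ← Ext.comp_assoc_of_third_deg_zero,
    ← hy, Ext.zero_comp]

lemma projective_H_obj [HasExt.{w'} A] [HasExt.{w} B] (h : IsHomologicalEmbedding.{w, w'} R.i)
    (P : B) [Projective P] [Projective (R.e.obj P)] : Projective (R.H.obj P) := by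
  have := R.subsingleton_ext_one_H h P (R.isZero_e_obj_kernel_lEToH P)
  have hS : (ShortComplex.mk _ _ (kernel.condition (R.lEToH P))).ShortExact :=
    { exact := ShortComplex.exact_kernel _ }
  -- The obstruction to lifting the identity of `H(P)` along `lEToH` lies in the vanishing `Ext¹`.
  obtain ⟨s, hs⟩ := Ext.covariant_sequence_exact₃ (R.H.obj P) hS (Ext.mk₀ (𝟙 _)) (zero_add 1)
    (Subsingleton.elim _ _)
  obtain ⟨s, rfl⟩ := (Ext.mk₀_bijective _ _).2 s
  rw [Ext.mk₀_comp_mk₀] at hs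
  have := R.isIso_lEToH_of_section P s ((Ext.mk₀_bijective _ _).1 hs)
  exact Projective.of_iso (asIso (R.lEToH P)) (R.adjLE.map_projective _ ‹_›)

lemma isHomologicalEmbedding_and_preservesProjectiveObjects_iff [HasExt.{w'} A] [HasExt.{w} B]
    [EnoughProjectives B] :
    (IsHomologicalEmbedding.{w, w'} R.i ∧ R.e.PreservesProjectiveObjects) ↔
      ∀ P : B, Projective P → Projective (R.H.obj P) := by
  constructor
  · rintro ⟨h, he⟩ P hP
    have := he.projective_obj hP
    exact R.projective_H_obj h P
  · intro h
    refine ⟨R.isHomologicalEmbedding_i h, ⟨fun {P} hP => ?_⟩⟩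
    have := h P hP
    exact R.projective_e_obj P

lemma iSup_projectiveDimension_i_le_iff (m : ℕ) :
    (⨆ P : {P : A // Projective P}, projectiveDimension (R.i.obj P.1)) ≤ (m : WithBot ℕ∞) ↔
      ∀ P : A, Projective P → HasProjectiveDimensionLE (R.i.obj P) m := by
  simp only [iSup_le_iff, projectiveDimension_le_iff, Subtype.forall]

lemma cosyzygies_le_rightExtOrthogonal_iff [HasExt.{w} B] [EnoughInjectives B] {m : ℕ}
    (hm : 1 ≤ m) :
    cosyzygies B m ≤ rightExtOrthogonal.{w} ((isProjective A).map R.i) ↔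
      ∀ P : A, Projective P → HasProjectiveDimensionLE (R.i.obj P) m := by
  constructor
  · intro h P hP
    rw [hasProjectiveDimensionLE_iff_cosyzygies.{w} _ hm]
    exact fun Z hZ n hn => h Z hZ _ (ObjectProperty.prop_map_obj _ _ hP) n hn
  · rintro h Z hZ X ⟨P, hP, ⟨t⟩⟩ n hn
    have := h P hP
    have : HasProjectiveDimensionLE X m := hasProjectiveDimensionLT_of_iso t _
    exact (hasProjectiveDimensionLE_iff_cosyzygies.{w} _ hm).1 this Z hZ n hn

end AbelianRecollement

theorem mainTheorem10 {A : Type u₁} {B : Type u₂} {C : Type u₃}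
    [Category.{v₁} A] [Category.{v₂} B] [Category.{v₃} C]
    [Abelian A] [Abelian B] [Abelian C] [HasExt.{w'} A] [HasExt.{w} B]
    [EnoughProjectives B] [EnoughInjectives B]
    (R : AbelianRecollement A B C) (m : ℕ) (hm : 1 ≤ m) :
    List.TFAE [
      (⨆ P : {P : A // Projective P}, projectiveDimension (R.i.obj P.1)) ≤ (m : WithBot ℕ∞),
      cosyzygies B m ≤ rightExtOrthogonal.{w} ((isProjective A).map R.i),
      ∀ P : B, Projective P → projectiveDimension (R.H.obj P) ≤ ((m - 1 : ℕ) : WithBot ℕ∞)] ∧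
    (m = 1 → List.TFAE [
      (⨆ P : {P : A // Projective P}, projectiveDimension (R.i.obj P.1)) ≤ (m : WithBot ℕ∞),
      cosyzygies B m ≤ rightExtOrthogonal.{w} ((isProjective A).map R.i),
      ∀ P : B, Projective P → projectiveDimension (R.H.obj P) ≤ ((m - 1 : ℕ) : WithBot ℕ∞),
      IsHomologicalEmbedding.{w, w'} R.i ∧ R.e.PreservesProjectiveObjects]) := by
  have h : List.TFAE [
      (⨆ P : {P : A // Projective P}, projectiveDimension (R.i.obj P.1)) ≤ (m : WithBot ℕ∞),
      cosyzygies B m ≤ rightExtOrthogonal.{w} ((isProjective A).map R.i),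
      ∀ P : B, Projective P →
        projectiveDimension (R.H.obj P) ≤ ((m - 1 : ℕ) : WithBot ℕ∞)] := by
    have h₁₂ := (R.iSup_projectiveDimension_i_le_iff m).trans
      (R.cosyzygies_le_rightExtOrthogonal_iff.{w} hm).symm
    tfae_have 1 ↔ 2 := h₁₂
    tfae_have 1 ↔ 3 := by
      -- Writing `m = n + 1` removes the truncated subtraction.
      obtain ⟨n, rfl⟩ := Nat.exists_eq_add_of_le' hm
      rw [R.iSup_projectiveDimension_i_le_iff, R.forall_hasProjectiveDimensionLE_i_iff]
      simp only [add_tsub_cancel_right, projectiveDimension_le_iff]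
    tfae_finish
  refine ⟨h, ?_⟩
  rintro rfl
  tfae_have 1 ↔ 2 := h.out 0 1
  tfae_have 1 ↔ 3 := h.out 0 2
  tfae_have 3 ↔ 4 := by
    rw [R.isHomologicalEmbedding_and_preservesProjectiveObjects_iff]
    simp only [tsub_self, projectiveDimension_le_iff, projective_iff_hasProjectiveDimensionLE_zero]
  tfae_finish
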